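/- Let $\Omega$ (states) and $A$ (actions) be finite sets, $A\neq\emptyset$. A Bayesian persuasion (BP) model $G=\{\Omega,A,\mu_0,u,v\}$ consists of a full-support prior $\mu_0\in\Delta(\Omega)$ and of receiver and sender utilities $u,v:A\times\Omega\to[0,1]$. A signal policy $\pi$ is a finite family of posteriors $\mu_i\in\Delta(\Omega)$ with weights $\alpha_i>0$, $\sum_i\alpha_i=1$, $\sum_i\alpha_i\mu_i=\mu_0$. For a receiver type $\theta$, identified with a utility profile $u_\theta:A\times\Omega\to\mathbb R$, put $\mathrm{opt}A_\theta(\mu)=\arg\max_{a\in A}\sum_\omega\mu(\omega)u_\theta(a,\omega)$, $$Ev_\theta(\pi)=\sum_i\alpha_i\max_{a\in \mathrm{opt}A_\theta(\mu_i)}\sum_\omega\mu_i(\omega)v(a,\omega),\qquad V(\theta)=\sup_\pi Ev_\theta(\pi).$$ Let $\theta_0$ be the type with $u_{\theta_0}=u$. A type set $\Theta$ is a $\delta$-BP model wrapping $G$ if it is a box $\prod_{(a,\omega)}[\underline u_{a,\omega},\underline u_{a,\omega}+\delta]$ with $\underline u_{a,\omega}<u(a,\omega)<\underline u_{a,\omega}+\delta$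 for all $(a,\omega)$. A policy is max-min for $\Theta$ if it maximizes $\inf_{\theta\in\Theta}Ev_\theta(\pi)$ over all policies $\pi$, and regret-minimizing for $\Theta$ if it minimizes $\sup_{\theta\in\Theta}[V(\theta)-Ev_\theta(\pi)]$; it is so up to $\eta$ if its value is within $\eta$ of being optimal, i.e. no policy improves on it by more than $\eta$. The model $G$ is continuous if for every $\varepsilon>0$ there is $\delta_0>0$ such that $|V(\theta)-V(\theta_0)|<\varepsilon$ for all $\delta<\delta_0$, all $\delta$-BP models $\Theta$ wrapping $G$ and all $\theta\in\Theta$. It is robust when the sender is max-min (respectively regret-minimizing) if for every $\varepsilon>0$ there is $\delta_0>0$ such that, for all $\delta<\delta_0$ and all $\delta$-BP models $\Theta$ wrapping $G$, every max-min (respectively regret-minimizing) policy $\pi$ for $\Theta$ satisfies $|Ev_\theta(\pi)-V(\theta_0)|<\varepsilon$ for all $\theta\in\Theta$. **Theorem.** Fix $\Omega,A,\mu_0,v$ as above. If the values $u(a,\omega)$, $(a,\omega)\in A\times\Omega$, are independent and uniformly distributed on $[0,1]$, then almost surely $G$ is continuous, robust when the sender is max-min, and robust when the sender is regret-minimizing.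 Moreover, almost surely both robustness properties hold with slack: for every $\varepsilon>0$ there are $\delta_0>0$ and $\eta>0$ such that, for all $\delta<\delta_0$ and all $\delta$-BP models $\Theta$ wrapping $G$, every policy $\pi$ that is max-min for $\Theta$ up to $\eta$, and every policy $\pi$ that is regret-minimizing for $\Theta$ up to $\eta$, satisfies $|Ev_\theta(\pi)-V(\theta_0)|<\varepsilon$ for all $\theta\in\Theta$. -/

import Mathlib

open MeasureTheory

noncomputable section

/-- A Bayesian persuasion model with finite state set `Ω` and finite action set `A`:
a full-support prior and utilities of the receiver (`u`) and of the sender (`v`) in `[0,1]`. -/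
structure BPModel (Ω A : Type*) [Fintype Ω] where
  prior : Ω → ℝ
  prior_mem : prior ∈ stdSimplex ℝ Ω
  prior_pos : ∀ ω, 0 < prior ω
  u : A × Ω → ℝ
  u_mem : ∀ x, u x ∈ Set.Icc (0 : ℝ) 1
  v : A × Ω → ℝ
  v_mem : ∀ x, v x ∈ Set.Icc (0 : ℝ) 1

/-- A signal policy: finitely many posterior beliefs with positive weights summing to one, whose
weighted average is the prior. (A posterior listed twice acts as one posterior with the total
weight.) -/
structure SignalPolicy {Ω : Type*} [Fintype Ω] (prior : Ω → ℝ) where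
  size : ℕ
  post : Fin size → Ω → ℝ
  weight : Fin size → ℝ
  post_mem : ∀ i, post i ∈ stdSimplex ℝ Ω
  weight_pos : ∀ i, 0 < weight i
  weight_sum : ∑ i, weight i = 1
  average : ∀ ω, ∑ i, weight i * post i ω = prior ω

/-- Expected value, under the belief `μ`, of the utility profile `w` when `a` is played. -/
def expUtil {Ω A : Type*} [Fintype Ω] (w : A × Ω → ℝ) (a : A) (μ : Ω → ℝ) : ℝ :=
  ∑ ω, μ ω * w (a, ω)

/-- The best replies at the belief `μ` of a receiver with utility profile `θ`. -/
def optA {Ω A : Type*} [Fintype Ω] (θ : A × Ω → ℝ) (μ : Ω → ℝ) : Set A :=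
  {a | ∀ b, expUtil θ b μ ≤ expUtil θ a μ}

namespace BPModel

variable {Ω A : Type*} [Fintype Ω]

/-- The sender's value of the posterior `μ` against a receiver with utility profile `θ`: the
maximum, over the receiver's best replies, of the sender's expected utility. (The set of best
replies is finite, and nonempty when `A` is, so that the supremum is a maximum.) -/
def senderVal (G : BPModel Ω A) (θ : A × Ω → ℝ) (μ : Ω → ℝ) : ℝ :=
  sSup ((fun a => expUtil G.v a μ) '' optA θ μ)

/-- `Ev_θ(π)`: the sender's expected utility from the policy `π` against the receiver `θ`. -/
def Ev (G : BPModel Ω A) (θ : A × Ω → ℝ) (π : SignalPolicy G.prior) : ℝ :=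
  ∑ i, π.weight i * G.senderVal θ (π.post i)

/-- The sender's optimal expected utility against a receiver known to be `θ`. -/
def optVal (G : BPModel Ω A) (θ : A × Ω → ℝ) : ℝ :=
  ⨆ π : SignalPolicy G.prior, G.Ev θ π

/-- Worst-case expected utility of `π` over the set `Θ` of receiver types. -/
def minUtil (G : BPModel Ω A) (Θ : Set (A × Ω → ℝ)) (π : SignalPolicy G.prior) : ℝ :=
  sInf ((fun θ => G.Ev θ π) '' Θ)

/-- Worst-case regret of `π` over the set `Θ` of receiver types. -/
def regret (G : BPModel Ω A) (Θ : Set (A × Ω → ℝ)) (π : SignalPolicy G.prior) : ℝ :=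
  sSup ((fun θ => G.optVal θ - G.Ev θ π) '' Θ)

/-- The type set `Θ` (a type being identified with its utility profile) makes up a `δ`-BP model
that wraps `G`: `Θ` is a full box all of whose sides have length `δ`, and the receiver's profile
in `G` is interior to it. -/
def WrappedBy (G : BPModel Ω A) (δ : ℝ) (Θ : Set (A × Ω → ℝ)) : Prop :=
  ∃ lo : A × Ω → ℝ,
    Θ = {θ | ∀ x, θ x ∈ Set.Icc (lo x) (lo x + δ)} ∧
    ∀ x, G.u x ∈ Set.Ioo (lo x) (lo x + δ)

/-- `π'` is a max-min policy for the type set `Θ`. -/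
def IsMaxMin (G : BPModel Ω A) (Θ : Set (A × Ω → ℝ)) (π' : SignalPolicy G.prior) : Prop :=
  ∀ π : SignalPolicy G.prior, G.minUtil Θ π ≤ G.minUtil Θ π'

/-- `π'` is a regret-minimizing policy for the type set `Θ`. -/
def IsRegretMin (G : BPModel Ω A) (Θ : Set (A × Ω → ℝ)) (π' : SignalPolicy G.prior) : Prop :=
  ∀ π : SignalPolicy G.prior, G.regret Θ π' ≤ G.regret Θ π

/-- `π'` is a max-min policy for `Θ` up to `η`. -/
def IsNearMaxMin (G : BPModel Ω A) (Θ : Set (A × Ω → ℝ)) (η : ℝ)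
    (π' : SignalPolicy G.prior) : Prop :=
  ∀ π : SignalPolicy G.prior, G.minUtil Θ π ≤ G.minUtil Θ π' + η

/-- `π'` is a regret-minimizing policy for `Θ` up to `η`. -/
def IsNearRegretMin (G : BPModel Ω A) (Θ : Set (A × Ω → ℝ)) (η : ℝ)
    (π' : SignalPolicy G.prior) : Prop :=
  ∀ π : SignalPolicy G.prior, G.regret Θ π' ≤ G.regret Θ π + η

/-- Continuity of a BP model. -/
def IsContinuous (G : BPModel Ω A) : Prop :=
  ∀ ε > 0, ∃ δ₀ > 0, ∀ δ < δ₀, ∀ Θ : Set (A × Ω → ℝ), G.WrappedBy δ Θ →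
    ∀ θ ∈ Θ, |G.optVal θ - G.optVal G.u| < ε

/-- Robustness when the sender is max-min. -/
def RobustMaxMin (G : BPModel Ω A) : Prop :=
  ∀ ε > 0, ∃ δ₀ > 0, ∀ δ < δ₀, ∀ Θ : Set (A × Ω → ℝ), G.WrappedBy δ Θ →
    ∀ π' : SignalPolicy G.prior, G.IsMaxMin Θ π' →
      ∀ θ ∈ Θ, |G.Ev θ π' - G.optVal G.u| < ε

/-- Robustness when the sender is regret-minimizing. -/
def RobustRegretMin (G : BPModel Ω A) : Prop :=
  ∀ ε > 0, ∃ δ₀ > 0, ∀ δ < δ₀, ∀ Θ : Set (A × Ω → ℝ), G.WrappedBy δ Θ →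
    ∀ π' : SignalPolicy G.prior, G.IsRegretMin Θ π' →
      ∀ θ ∈ Θ, |G.Ev θ π' - G.optVal G.u| < ε

/-- Robustness when the sender is max-min up to a small slack. Policies that are max-min up to a
positive slack always exist, so that this is informative even for type sets where no finitely
supported policy attains the max-min value. -/
def RobustNearMaxMin (G : BPModel Ω A) : Prop :=
  ∀ ε > 0, ∃ δ₀ > 0, ∃ η > 0, ∀ δ < δ₀, ∀ Θ : Set (A × Ω → ℝ), G.WrappedBy δ Θ →
    ∀ π' : SignalPolicy G.prior, G.IsNearMaxMin Θ η π' →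
      ∀ θ ∈ Θ, |G.Ev θ π' - G.optVal G.u| < ε

/-- Robustness when the sender is regret-minimizing up to a small slack. -/
def RobustNearRegretMin (G : BPModel Ω A) : Prop :=
  ∀ ε > 0, ∃ δ₀ > 0, ∃ η > 0, ∀ δ < δ₀, ∀ Θ : Set (A × Ω → ℝ), G.WrappedBy δ Θ →
    ∀ π' : SignalPolicy G.prior, G.IsNearRegretMin Θ η π' →
      ∀ θ ∈ Θ, |G.Ev θ π' - G.optVal G.u| < ε

end BPModel

/-- The law of a receiver's utility profile whose values are i.i.d. uniform on `[0,1]`. -/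
def uniformProfile (Ω A : Type*) [Fintype Ω] [Fintype A] : Measure (A × Ω → ℝ) :=
  Measure.pi fun _ : A × Ω => (volume : Measure ℝ).restrict (Set.Icc 0 1)

/-- A property `U` of BP models is generic if, for every full-support prior and every sender
utility, it holds almost surely when the receiver's utilities are i.i.d. uniform on `[0,1]`. -/
def IsGeneric {Ω A : Type*} [Fintype Ω] [Fintype A] (U : BPModel Ω A → Prop) : Prop :=
  ∀ (prior : Ω → ℝ) (h_mem : prior ∈ stdSimplex ℝ Ω) (h_pos : ∀ ω, 0 < prior ω)
    (v : A × Ω → ℝ) (hv : ∀ x, v x ∈ Set.Icc (0 : ℝ) 1),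
    ∀ᵐ u ∂(uniformProfile Ω A), ∃ hu : ∀ x, u x ∈ Set.Icc (0 : ℝ) 1,
      U { prior := prior, prior_mem := h_mem, prior_pos := h_pos,
          u := u, u_mem := hu, v := v, v_mem := hv }

end

/-!
The transfer of policies between nearby receiver types rests on a margin: for almost every profile
`u` there is `γ > 0` such that each action is either the best reply by at least `γ` at some belief,
or worse than some other action by at least `γ` at every belief (`IsDecisive`). An action for which
no such `γ` exists is a best reply up to arbitrarily small errors, but never strictly; raising all
of its payoffs by a common `t > 0` makes it a strict best reply somewhere. Hence the set of
profiles that are bad for a given action is disjoint from its translates in that direction, and,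
being closed, it is null (`volume_compl_hasMargin`).

If `u` is decisive and `θ` is close to `u`, an action that `θ` plays at a posterior `μ` must have a
belief `ν` at which it is strictly optimal under `u`. Moving `μ` slightly towards `ν` makes the
action optimal for all types close to `u` at once. Since the prior has full support, one additional
posterior of small weight restores the average of the posteriors to the prior. So every policy for
`θ` is turned into a policy that does almost as well against every type near `u`
(`BPModel.exists_robust_policy`). Used with `θ = u` this yields one policy that guarantees nearly
`V(u)` against all nearby types, and used in the other direction it yields `V(θ) ≤ V(u) + ε`
(`BPModel.exists_radius`). Continuity and all the robustness properties follow from these two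
bounds by comparison with that one policy.
-/

/-! ### Expected utilities -/

section ExpUtil

variable {Ω A : Type*} [Fintype Ω]

theorem expUtil_le_add {w w' : A × Ω → ℝ} {δ : ℝ} (h : ∀ x, w x ≤ w' x + δ) (a : A)
    {μ : Ω → ℝ} (hμ : μ ∈ stdSimplex ℝ Ω) : expUtil w a μ ≤ expUtil w' a μ + δ := by
  have h1 : δ = ∑ ω, μ ω * δ := by rw [← Finset.sum_mul, hμ.2, one_mul]
  rw [h1, expUtil, expUtil, ← Finset.sum_add_distrib]
  refine Finset.sum_le_sum fun ω _ => ?_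
  rw [← mul_add]
  exact mul_le_mul_of_nonneg_left (h _) (hμ.1 ω)

theorem expUtil_nonneg {w : A × Ω → ℝ} (h : ∀ x, 0 ≤ w x) (a : A)
    {μ : Ω → ℝ} (hμ : μ ∈ stdSimplex ℝ Ω) : 0 ≤ expUtil w a μ :=
  Finset.sum_nonneg fun ω _ => mul_nonneg (hμ.1 ω) (h _)

theorem expUtil_le_one {w : A × Ω → ℝ} (h : ∀ x, w x ≤ 1) (a : A)
    {μ : Ω → ℝ} (hμ : μ ∈ stdSimplex ℝ Ω) : expUtil w a μ ≤ 1 := by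
  rw [← hμ.2]
  exact Finset.sum_le_sum fun ω _ => mul_le_of_le_one_right (hμ.1 ω) (h _)

theorem expUtil_combo (w : A × Ω → ℝ) (a : A) (p q : ℝ) (μ ν : Ω → ℝ) :
    expUtil w a (p • μ + q • ν) = p * expUtil w a μ + q * expUtil w a ν := by
  simp only [expUtil, Finset.mul_sum, ← Finset.sum_add_distrib]
  refine Finset.sum_congr rfl fun ω _ => ?_
  simp only [Pi.add_apply, Pi.smul_apply, smul_eq_mul]
  ring

theorem optA_nonempty [Finite A] [Nonempty A] (θ : A × Ω → ℝ) (μ : Ω → ℝ) :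
    (optA θ μ).Nonempty :=
  Finite.exists_max fun a => expUtil θ a μ

end ExpUtil

/-! ### Values of policies -/

namespace BPModel

variable {Ω A : Type*} [Fintype Ω]

instance nonempty_signalPolicy (G : BPModel Ω A) : Nonempty (SignalPolicy G.prior) :=
  ⟨{ size := 1
     post := fun _ => G.prior
     weight := fun _ => 1
     post_mem := fun _ => G.prior_mem
     weight_pos := fun _ => one_pos
     weight_sum := by simp
     average := by simp }⟩

theorem optVal_le (G : BPModel Ω A) {θ : A × Ω → ℝ} {c : ℝ}
    (h : ∀ π : SignalPolicy G.prior, G.Ev θ π ≤ c) : G.optVal θ ≤ c :=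
  ciSup_le h

theorem exists_lt_Ev (G : BPModel Ω A) {θ : A × Ω → ℝ} {c : ℝ} (h : c < G.optVal θ) :
    ∃ π : SignalPolicy G.prior, c < G.Ev θ π :=
  exists_lt_of_lt_ciSup h

variable [Finite A]

theorem le_senderVal (G : BPModel Ω A) {θ : A × Ω → ℝ} {μ : Ω → ℝ} {a : A}
    (ha : a ∈ optA θ μ) : expUtil G.v a μ ≤ G.senderVal θ μ :=
  le_csSup (Set.toFinite _).bddAbove ⟨a, ha, rfl⟩

variable [Nonempty A]

theorem exists_senderVal_eq (G : BPModel Ω A) (θ : A × Ω → ℝ) (μ : Ω → ℝ) :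
    ∃ a ∈ optA θ μ, expUtil G.v a μ = G.senderVal θ μ :=
  ((optA_nonempty θ μ).image _).csSup_mem (Set.toFinite _)

theorem senderVal_mem (G : BPModel Ω A) (θ : A × Ω → ℝ) {μ : Ω → ℝ}
    (hμ : μ ∈ stdSimplex ℝ Ω) : G.senderVal θ μ ∈ Set.Icc (0 : ℝ) 1 := by
  obtain ⟨a, -, h⟩ := G.exists_senderVal_eq θ μ
  rw [← h]
  exact ⟨expUtil_nonneg (fun x => (G.v_mem x).1) a hμ, expUtil_le_one (fun x => (G.v_mem x).2) a hμ⟩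

theorem Ev_mem (G : BPModel Ω A) (θ : A × Ω → ℝ) (π : SignalPolicy G.prior) :
    G.Ev θ π ∈ Set.Icc (0 : ℝ) 1 := by
  refine ⟨Finset.sum_nonneg fun i _ =>
    mul_nonneg (π.weight_pos i).le (G.senderVal_mem θ (π.post_mem i)).1, ?_⟩
  rw [← π.weight_sum]
  exact Finset.sum_le_sum fun i _ =>
    mul_le_of_le_one_right (π.weight_pos i).le (G.senderVal_mem θ (π.post_mem i)).2

theorem Ev_le_optVal (G : BPModel Ω A) (θ : A × Ω → ℝ) (π : SignalPolicy G.prior) :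
    G.Ev θ π ≤ G.optVal θ :=
  le_ciSup (f := fun π => G.Ev θ π) ⟨1, by rintro _ ⟨π, rfl⟩; exact (G.Ev_mem θ π).2⟩ π

theorem minUtil_le (G : BPModel Ω A) {Θ : Set (A × Ω → ℝ)} {θ : A × Ω → ℝ} (hθ : θ ∈ Θ)
    (π : SignalPolicy G.prior) : G.minUtil Θ π ≤ G.Ev θ π :=
  csInf_le ⟨0, by rintro _ ⟨θ, -, rfl⟩; exact (G.Ev_mem θ π).1⟩ ⟨θ, hθ, rfl⟩

theorem le_regret (G : BPModel Ω A) {Θ : Set (A × Ω → ℝ)} {θ : A × Ω → ℝ} (hθ : θ ∈ Θ)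
    (π : SignalPolicy G.prior) : G.optVal θ - G.Ev θ π ≤ G.regret Θ π := by
  refine le_csSup ⟨1, ?_⟩ ⟨θ, hθ, rfl⟩
  rintro _ ⟨θ, -, rfl⟩
  have h1 := G.optVal_le fun π => (G.Ev_mem θ π).2
  have h2 := (G.Ev_mem θ π).1
  dsimp only
  linarith

end BPModel

/-! ### Decisive profiles are generic -/

section Decisive

variable {Ω A : Type*} [Fintype Ω]

/-- The action `a` has margin `γ` under the profile `u`: either it beats all other actions by `γ`
at some belief, or at every belief it is beaten by `γ`. -/
def HasMargin (u : A × Ω → ℝ) (a : A) (γ : ℝ) : Prop :=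
  (∃ ν ∈ stdSimplex ℝ Ω, ∀ b, b ≠ a → expUtil u b ν + γ ≤ expUtil u a ν) ∨
    ∀ μ ∈ stdSimplex ℝ Ω, ∃ b, expUtil u a μ + γ ≤ expUtil u b μ

/-- A profile under which all actions have a common positive margin. -/
def IsDecisive (u : A × Ω → ℝ) : Prop :=
  ∃ γ > 0, ∀ a, HasMargin u a γ

theorem HasMargin.mono {u : A × Ω → ℝ} {a : A} {γ γ' : ℝ} (h : HasMargin u a γ) (hγ : γ' ≤ γ) :
    HasMargin u a γ' := by
  rcases h with ⟨ν, hν, h⟩ | h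
  · exact Or.inl ⟨ν, hν, fun b hb => by linarith [h b hb]⟩
  · refine Or.inr fun μ hμ => ?_
    obtain ⟨b, hb⟩ := h μ hμ
    exact ⟨b, by linarith⟩

theorem HasMargin.of_near {u w : A × Ω → ℝ} {a : A} {γ δ : ℝ} (h : HasMargin u a γ)
    (hw : ∀ x, |w x - u x| ≤ δ) : HasMargin w a (γ - 2 * δ) := by
  have h1 : ∀ x, w x ≤ u x + δ := fun x => by linarith [(abs_le.1 (hw x)).2]
  have h2 : ∀ x, u x ≤ w x + δ := fun x => by linarith [(abs_le.1 (hw x)).1]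
  rcases h with ⟨ν, hν, h⟩ | h
  · exact Or.inl ⟨ν, hν, fun b hb => by
      linarith [h b hb, expUtil_le_add h1 b hν, expUtil_le_add h2 a hν]⟩
  · refine Or.inr fun μ hμ => ?_
    obtain ⟨b, hb⟩ := h μ hμ
    exact ⟨b, by linarith [expUtil_le_add h1 a hμ, expUtil_le_add h2 b hμ]⟩

theorem isDecisive_of_forall [Finite A] [Nonempty A] {u : A × Ω → ℝ}
    (h : ∀ a, ∃ γ > 0, HasMargin u a γ) : IsDecisive u := by
  choose γ hγ h using h
  obtain ⟨a₀, ha₀⟩ := Finite.exists_min γ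
  exact ⟨γ a₀, hγ a₀, fun a => (h a).mono (ha₀ a)⟩

theorem isOpen_hasMargin [Fintype A] (a : A) :
    IsOpen {u : A × Ω → ℝ | ∃ γ > 0, HasMargin u a γ} := by
  rw [Metric.isOpen_iff]
  rintro u ⟨γ, hγ, h⟩
  refine ⟨γ / 4, by positivity, fun w hw => ⟨γ - 2 * (γ / 4), by linarith, h.of_near fun x => ?_⟩⟩
  have := (dist_le_pi_dist w u x).trans (Metric.mem_ball.1 hw).le
  rwa [Real.dist_eq] at this

/-- If `a` has no margin, then raising all payoffs of `a` by the same amount `t > 0` gives it one: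
`a` was within `t / 2` of optimal at some belief, and becomes the best reply there by `t / 2`. -/
theorem exists_hasMargin_raise {a : A} {u w : A × Ω → ℝ} {t : ℝ} (ht : 0 < t)
    (hu : ¬ ∃ γ > 0, HasMargin u a γ) (hwa : ∀ ω, w (a, ω) = u (a, ω) + t)
    (hwb : ∀ b, b ≠ a → ∀ ω, w (b, ω) = u (b, ω)) : ∃ γ > 0, HasMargin w a γ := by
  refine ⟨t / 2, half_pos ht, Or.inl ?_⟩
  have h1 : ¬ HasMargin u a (t / 2) := fun h => hu ⟨t / 2, half_pos ht, h⟩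
  simp only [HasMargin, not_or] at h1
  obtain ⟨-, h2⟩ := h1
  push Not at h2
  obtain ⟨μ, hμ, h2⟩ := h2
  refine ⟨μ, hμ, fun b hb => ?_⟩
  have e1 : expUtil w b μ = expUtil u b μ := by simp only [expUtil, hwb b hb]
  have e2 : expUtil w a μ = expUtil u a μ + t := by
    simp only [expUtil, hwa, mul_add, Finset.sum_add_distrib, ← Finset.sum_mul, hμ.2, one_mul]
  rw [e1, e2]
  linarith [h2 b]

theorem volume_compl_hasMargin [Fintype A] (a : A) :
    volume {u : A × Ω → ℝ | ¬ ∃ γ > 0, HasMargin u a γ} = 0 := by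
  classical
  let e : A × Ω → ℝ := fun x => if x.1 = a then 1 else 0
  let c : ℕ → ℝ := fun n => 1 / ((n : ℝ) + 1)
  have hc : StrictAnti c := fun m n hmn => by
    have : (m : ℝ) < n := by exact_mod_cast hmn
    exact one_div_lt_one_div_of_lt (by positivity) (by linarith)
  have key : ∀ m n, m < n → ∀ x y : A × Ω → ℝ, (¬ ∃ γ > 0, HasMargin x a γ) →
      (¬ ∃ γ > 0, HasMargin y a γ) → c m • e + x ≠ c n • e + y := by
    intro m n hmn x y hx hy hxy
    refine hy (exists_hasMargin_raise (sub_pos.2 (hc hmn)) hx (fun ω => ?_) fun b hb ω => ?_)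
    · have := congrFun hxy (a, ω)
      simp [e] at this
      linarith
    · have := congrFun hxy (b, ω)
      simp [e, hb] at this
      linarith
  refine Measure.addHaar_eq_zero_of_disjoint_translates volume (u := fun n => c n • e) ?_ ?_ ?_
  · refine (Metric.isBounded_closedBall (x := (0 : A × Ω → ℝ)) (r := ‖e‖)).subset ?_
    rintro _ ⟨n, rfl⟩
    have h0 : 0 ≤ c n := by positivity
    have h1 : c n ≤ 1 := by
      have : (0 : ℝ) ≤ n := n.cast_nonneg
      exact (div_le_one (by positivity)).2 (by linarith)
    rw [mem_closedBall_zero_iff, norm_smul, Real.norm_of_nonneg h0]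
    exact mul_le_of_le_one_left (norm_nonneg e) h1
  · intro m n hmn
    refine Set.disjoint_left.2 fun z hz hz' => ?_
    obtain ⟨_, rfl, x, hx, rfl⟩ := hz
    obtain ⟨_, rfl, y, hy, hxy⟩ := hz'
    rcases lt_or_gt_of_ne hmn with h | h
    · exact key m n h x y hx hy hxy.symm
    · exact key n m h y x hy hx hxy
  · exact (isOpen_hasMargin a).measurableSet.compl

theorem ae_uniformProfile [Fintype A] [Nonempty A] :
    ∀ᵐ u ∂(uniformProfile Ω A), (∀ x, u x ∈ Set.Icc (0 : ℝ) 1) ∧ IsDecisive u := by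
  have h1 : uniformProfile Ω A = (volume : Measure (A × Ω → ℝ)).restrict
      (Set.univ.pi fun _ => Set.Icc 0 1) := by
    rw [volume_pi, Measure.restrict_pi_pi, uniformProfile]
  have h2 : ∀ᵐ u : A × Ω → ℝ, ∀ a : A, ∃ γ > 0, HasMargin u a γ :=
    ae_all_iff.2 fun a => volume_compl_hasMargin a
  rw [h1]
  filter_upwards [ae_restrict_mem (MeasurableSet.univ_pi fun _ => measurableSet_Icc),
    ae_restrict_of_ae h2] with u hu h
  exact ⟨fun x => hu x (Set.mem_univ x), isDecisive_of_forall h⟩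

end Decisive

/-! ### Transfer of policies between nearby types -/

namespace BPModel

variable {Ω A : Type*} [Fintype Ω]

/-- Posteriors moved from `post i` by a fraction `s * m` towards beliefs `ν i` still form, with
total weight `1 - s`, part of a policy, if `m` is a lower bound for the prior. The remaining
weight `s` goes to a single posterior `ρ`. The new policy is described by the weighted sums of
arbitrary functions `F` of the posterior. -/
theorem exists_tilted_policy (G : BPModel Ω A) (π : SignalPolicy G.prior)
    (ν : Fin π.size → Ω → ℝ) (hν : ∀ i, ν i ∈ stdSimplex ℝ Ω) {s m : ℝ} (hs : 0 < s) (hs1 : s < 1)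
    (hm : 0 < m) (hm1 : m ≤ 1) (hprior : ∀ ω, m ≤ G.prior ω) :
    ∃ ρ ∈ stdSimplex ℝ Ω, ∃ π' : SignalPolicy G.prior, ∀ F : (Ω → ℝ) → ℝ,
      ∑ i, π'.weight i * F (π'.post i) = s * F ρ + ∑ i, (1 - s) * π.weight i *
        F ((1 - s * m) • π.post i + (s * m) • ν i) := by
  have hsm : 0 < s * m := mul_pos hs hm
  have hsm1 : s * m < 1 := by nlinarith
  -- the average of the beliefs `ν i`
  let N : Ω → ℝ := fun ω => ∑ i, π.weight i * ν i ω
  have hN1 : ∀ ω, N ω ≤ 1 := fun ω => by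
    rw [← π.weight_sum]
    refine Finset.sum_le_sum fun i _ => mul_le_of_le_one_right (π.weight_pos i).le ?_
    rw [← (hν i).2]
    exact Finset.single_le_sum (fun ω _ => (hν i).1 ω) (Finset.mem_univ ω)
  have hNs : ∑ ω, N ω = 1 := by
    rw [Finset.sum_comm, ← π.weight_sum]
    refine Finset.sum_congr rfl fun i _ => ?_
    rw [← Finset.mul_sum, (hν i).2, mul_one]
  -- the belief that brings the average back to the prior
  let ρ : Ω → ℝ := fun ω =>
    (G.prior ω - (1 - s) * ((1 - s * m) * G.prior ω + s * m * N ω)) / s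
  have hρ : ρ ∈ stdSimplex ℝ Ω := by
    constructor
    · intro ω
      refine div_nonneg ?_ hs.le
      have h1 : (1 - s) * (s * m * N ω) ≤ s * m :=
        (mul_le_of_le_one_left
          (mul_nonneg hsm.le (Finset.sum_nonneg fun i _ =>
            mul_nonneg (π.weight_pos i).le ((hν i).1 ω))) (by linarith)).trans
          (mul_le_of_le_one_right hsm.le (hN1 ω))
      have h2 : s * m ≤ s * G.prior ω := mul_le_mul_of_nonneg_left (hprior ω) hs.le
      have h3 : 0 ≤ (1 - s) * (s * m * G.prior ω) :=
        mul_nonneg (by linarith) (mul_nonneg hsm.le (G.prior_pos ω).le)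
      linarith
    · have : ∑ ω, (G.prior ω - (1 - s) * ((1 - s * m) * G.prior ω + s * m * N ω)) = s := by
        rw [Finset.sum_sub_distrib, ← Finset.mul_sum, Finset.sum_add_distrib, ← Finset.mul_sum,
          ← Finset.mul_sum, hNs, G.prior_mem.2]
        ring
      rw [← Finset.sum_div, this, div_self hs.ne']
  have hpost : ∀ i, (1 - s * m) • π.post i + (s * m) • ν i ∈ stdSimplex ℝ Ω := fun i =>
    convex_stdSimplex ℝ Ω (π.post_mem i) (hν i) (by linarith) hsm.le (by ring)
  refine ⟨ρ, hρ, { size := π.size + 1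
                   post := Fin.cons ρ fun i => (1 - s * m) • π.post i + (s * m) • ν i
                   weight := Fin.cons s fun i => (1 - s) * π.weight i
                   post_mem := Fin.cases hρ hpost
                   weight_pos := Fin.cases hs fun i => mul_pos (by linarith) (π.weight_pos i)
                   weight_sum := ?_
                   average := fun ω => ?_ }, fun F => ?_⟩
  · rw [Fin.sum_univ_succ]
    simp only [Fin.cons_zero, Fin.cons_succ]
    rw [← Finset.mul_sum, π.weight_sum]
    ring
  · have h : ∑ i, (1 - s) * π.weight i * ((1 - s * m) * π.post i ω + s * m * ν i ω) =
        (1 - s) * ((1 - s * m) * G.prior ω + s * m * N ω) := by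
      rw [← π.average ω, Finset.mul_sum, Finset.mul_sum, ← Finset.sum_add_distrib, Finset.mul_sum]
      exact Finset.sum_congr rfl fun i _ => by ring
    rw [Fin.sum_univ_succ]
    simp only [Fin.cons_zero, Fin.cons_succ, Pi.add_apply, Pi.smul_apply, smul_eq_mul]
    rw [h]
    simp only [ρ]
    rw [mul_div_cancel₀ _ hs.ne']
    ring
  · simp only [Fin.sum_univ_succ, Fin.cons_zero, Fin.cons_succ]

variable [Finite A] [Nonempty A]

/-- A policy aimed at a type `θ` near a decisive profile can be replaced by one that does almost as
well against all types near that profile. -/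
theorem exists_robust_policy (G : BPModel Ω A) {γ : ℝ} (hγ : ∀ a, HasMargin G.u a γ)
    {s m δ : ℝ} (hs : 0 < s) (hs1 : s < 1) (hm : 0 < m) (hm1 : m ≤ 1)
    (hprior : ∀ ω, m ≤ G.prior ω) (hδ : 0 < δ) (hδγ : 4 * δ ≤ s * m * γ)
    {θ : A × Ω → ℝ} (hθ : ∀ x, |θ x - G.u x| ≤ δ) (π : SignalPolicy G.prior) :
    ∃ π' : SignalPolicy G.prior, ∀ θ' : A × Ω → ℝ, (∀ x, |θ' x - G.u x| ≤ δ) →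
      (1 - s) * (1 - s) * G.Ev θ π ≤ G.Ev θ' π' := by
  have hsm : 0 < s * m := mul_pos hs hm
  have hsms : s * m ≤ s := mul_le_of_le_one_right hs.le hm1
  have hγ0 : 0 < γ := by
    by_contra hcon
    nlinarith [mul_nonneg hsm.le (sub_nonneg.2 (not_lt.1 hcon))]
  have hγ4 : 4 * δ < γ := hδγ.trans_lt (mul_lt_of_lt_one_left hγ0 (by linarith))
  have near : ∀ {w : A × Ω → ℝ}, (∀ x, |w x - G.u x| ≤ δ) → ∀ (a : A) {μ : Ω → ℝ},
      μ ∈ stdSimplex ℝ Ω →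
      expUtil w a μ ≤ expUtil G.u a μ + δ ∧ expUtil G.u a μ ≤ expUtil w a μ + δ :=
    fun hw a μ hμ => ⟨expUtil_le_add (fun x => by linarith [(abs_le.1 (hw x)).2]) a hμ,
      expUtil_le_add (fun x => by linarith [(abs_le.1 (hw x)).1]) a hμ⟩
  choose a ha hav using fun i => G.exists_senderVal_eq θ (π.post i)
  -- an action played by `θ` cannot be beaten by `γ` under `u`, so it has a belief where it wins
  have hex : ∀ i, ∃ ν ∈ stdSimplex ℝ Ω, ∀ b, b ≠ a i → expUtil G.u b ν + γ ≤
      expUtil G.u (a i) ν := by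
    intro i
    refine (hγ (a i)).resolve_right fun h => ?_
    obtain ⟨b, hb⟩ := h _ (π.post_mem i)
    linarith [ha i b, (near hθ b (π.post_mem i)).2, (near hθ (a i) (π.post_mem i)).1]
  choose ν hν hνa using hex
  obtain ⟨ρ, hρ, π', hπ'⟩ := G.exists_tilted_policy π ν hν hs hs1 hm hm1 hprior
  refine ⟨π', fun θ' hθ' => ?_⟩
  have hopt : ∀ i, a i ∈ optA θ' ((1 - s * m) • π.post i + (s * m) • ν i) := by
    intro i b
    rcases eq_or_ne b (a i) with rfl | hb
    · exact le_rfl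
    have h1 : expUtil θ' b (π.post i) ≤ expUtil θ' (a i) (π.post i) + 4 * δ := by
      linarith [ha i b, near hθ b (π.post_mem i), near hθ (a i) (π.post_mem i),
        near hθ' b (π.post_mem i), near hθ' (a i) (π.post_mem i)]
    have h2 : expUtil θ' b (ν i) + (γ - 2 * δ) ≤ expUtil θ' (a i) (ν i) := by
      linarith [hνa i b hb, near hθ' b (hν i), near hθ' (a i) (hν i)]
    rw [expUtil_combo, expUtil_combo]
    have h3 := mul_le_mul_of_nonneg_left h1 (by linarith : 0 ≤ 1 - s * m)
    have h4 := mul_le_mul_of_nonneg_left h2 hsm.le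
    linarith [mul_pos hsm hδ]
  have hval : ∀ i, (1 - s) * G.senderVal θ (π.post i) ≤
      G.senderVal θ' ((1 - s * m) • π.post i + (s * m) • ν i) := by
    intro i
    refine le_trans ?_ (G.le_senderVal (hopt i))
    rw [expUtil_combo, ← hav i]
    have h1 := expUtil_nonneg (fun x => (G.v_mem x).1) (a i) (π.post_mem i)
    have h2 := mul_nonneg hsm.le (expUtil_nonneg (fun x => (G.v_mem x).1) (a i) (hν i))
    have h3 := mul_le_mul_of_nonneg_right (by linarith : 1 - s ≤ 1 - s * m) h1
    linarith
  rw [Ev, Ev, hπ', Finset.mul_sum]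
  refine le_add_of_nonneg_of_le (mul_nonneg hs.le (G.senderVal_mem θ' hρ).1)
    (Finset.sum_le_sum fun i _ => ?_)
  calc (1 - s) * (1 - s) * (π.weight i * G.senderVal θ (π.post i))
      = (1 - s) * π.weight i * ((1 - s) * G.senderVal θ (π.post i)) := by ring
    _ ≤ _ := mul_le_mul_of_nonneg_left (hval i)
        (mul_nonneg (by linarith) (π.weight_pos i).le)

/-- Near a decisive profile the sender's optimal value is bounded above by nearly `V(u)`, and a
single policy guarantees nearly `V(u)`. -/
theorem exists_radius (G : BPModel Ω A) (hG : IsDecisive G.u) {ε : ℝ} (hε : 0 < ε) :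
    ∃ δ > 0, ∃ π₀ : SignalPolicy G.prior, ∀ θ : A × Ω → ℝ, (∀ x, |θ x - G.u x| ≤ δ) →
      G.optVal θ ≤ G.optVal G.u + ε ∧ G.optVal G.u - ε ≤ G.Ev θ π₀ := by
  obtain ⟨γ, hγ, hmar⟩ := hG
  have hΩ : Nonempty Ω := by
    by_contra h
    rw [not_nonempty_iff] at h
    simpa using G.prior_mem.2
  obtain ⟨ω₀, hω₀⟩ := Finite.exists_min G.prior
  have hm1 : G.prior ω₀ ≤ 1 := by
    rw [← G.prior_mem.2]
    exact Finset.single_le_sum (fun ω _ => G.prior_mem.1 ω) (Finset.mem_univ ω₀)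
  have hm := G.prior_pos ω₀
  -- a fraction of at most `2 * s ≤ ε / 2` of the value is lost in a transfer
  obtain ⟨s, hs, hs1, hsε⟩ : ∃ s : ℝ, 0 < s ∧ s < 1 ∧ 4 * s ≤ ε :=
    ⟨min (1 / 2) (ε / 4), by positivity, (min_le_left _ _).trans_lt (by norm_num),
      by linarith [min_le_right (1 / 2 : ℝ) (ε / 4)]⟩
  have hloss : ∀ (θ : A × Ω → ℝ) (π : SignalPolicy G.prior),
      G.Ev θ π - 2 * s ≤ (1 - s) * (1 - s) * G.Ev θ π := fun θ π => by
    obtain ⟨h0, h1⟩ := G.Ev_mem θ π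
    nlinarith [mul_nonneg (mul_self_nonneg s) h0, mul_nonneg hs.le (sub_nonneg.2 h1)]
  have hδ : 0 < s * G.prior ω₀ * γ / 4 := by positivity
  have hself : ∀ x, |G.u x - G.u x| ≤ s * G.prior ω₀ * γ / 4 := fun x => by simpa using hδ.le
  have htr := fun {θ : A × Ω → ℝ} (hθ : ∀ x, |θ x - G.u x| ≤ s * G.prior ω₀ * γ / 4) =>
    G.exists_robust_policy hmar hs hs1 hm hm1 hω₀ hδ (by linarith) hθ
  obtain ⟨π₁, hπ₁⟩ := G.exists_lt_Ev (sub_lt_self (G.optVal G.u) (half_pos hε))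
  obtain ⟨π₀, hπ₀⟩ := htr hself π₁
  refine ⟨_, hδ, π₀, fun θ hθ => ⟨G.optVal_le fun π => ?_, ?_⟩⟩
  · obtain ⟨π', hπ'⟩ := htr hθ π
    linarith [hπ' G.u hself, G.Ev_le_optVal G.u π', hloss θ π]
  · linarith [hπ₀ θ hθ, hloss G.u π₁]

end BPModel

/-! ### Continuity and robustness of decisive models -/

namespace BPModel

variable {Ω A : Type*} [Fintype Ω]

theorem WrappedBy.mem_u {G : BPModel Ω A} {δ : ℝ} {Θ : Set (A × Ω → ℝ)} (h : G.WrappedBy δ Θ) :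
    G.u ∈ Θ := by
  obtain ⟨lo, rfl, h⟩ := h
  exact fun x => Set.Ioo_subset_Icc_self (h x)

theorem WrappedBy.abs_sub_le {G : BPModel Ω A} {δ : ℝ} {Θ : Set (A × Ω → ℝ)}
    (h : G.WrappedBy δ Θ) {θ : A × Ω → ℝ} (hθ : θ ∈ Θ) (x : A × Ω) : |θ x - G.u x| ≤ δ := by
  obtain ⟨lo, rfl, h⟩ := h
  have h1 := h x
  have h2 := hθ x
  exact abs_le.2 ⟨by linarith [h1.2, h2.1], by linarith [h1.1, h2.2]⟩

theorem RobustNearMaxMin.robustMaxMin {G : BPModel Ω A} (h : G.RobustNearMaxMin) :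
    G.RobustMaxMin := by
  intro ε hε
  obtain ⟨δ₀, hδ₀, η, hη, h⟩ := h ε hε
  exact ⟨δ₀, hδ₀, fun δ hδ Θ hΘ π' hπ' =>
    h δ hδ Θ hΘ π' fun π => (hπ' π).trans (le_add_of_nonneg_right hη.le)⟩

theorem RobustNearRegretMin.robustRegretMin {G : BPModel Ω A} (h : G.RobustNearRegretMin) :
    G.RobustRegretMin := by
  intro ε hε
  obtain ⟨δ₀, hδ₀, η, hη, h⟩ := h ε hε
  exact ⟨δ₀, hδ₀, fun δ hδ Θ hΘ π' hπ' =>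
    h δ hδ Θ hΘ π' fun π => (hπ' π).trans (le_add_of_nonneg_right hη.le)⟩

variable [Finite A] [Nonempty A]

theorem isContinuous_of_isDecisive (G : BPModel Ω A) (hG : IsDecisive G.u) :
    G.IsContinuous := by
  intro ε hε
  obtain ⟨δ₀, hδ₀, π₀, h⟩ := G.exists_radius hG (half_pos hε)
  refine ⟨δ₀, hδ₀, fun δ hδ Θ hΘ θ hθ => ?_⟩
  obtain ⟨h1, h2⟩ := h θ fun x => (hΘ.abs_sub_le hθ x).trans hδ.le
  exact abs_lt.2 ⟨by linarith [G.Ev_le_optVal θ π₀], by linarith⟩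

theorem robustNearMaxMin_of_isDecisive (G : BPModel Ω A) (hG : IsDecisive G.u) :
    G.RobustNearMaxMin := by
  intro ε hε
  obtain ⟨δ₀, hδ₀, π₀, h⟩ := G.exists_radius hG (by positivity : 0 < ε / 4)
  refine ⟨δ₀, hδ₀, ε / 4, by positivity, fun δ hδ Θ hΘ π' hπ' θ hθ => ?_⟩
  have hnear := fun θ hθ => h θ fun x => (hΘ.abs_sub_le hθ x).trans hδ.le
  have h1 : G.optVal G.u - ε / 4 ≤ G.minUtil Θ π₀ := by
    refine le_csInf ⟨_, G.u, hΘ.mem_u, rfl⟩ ?_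
    rintro _ ⟨θ, hθ, rfl⟩
    exact (hnear θ hθ).2
  exact abs_lt.2 ⟨by linarith [hπ' π₀, G.minUtil_le hθ π'],
    by linarith [(hnear θ hθ).1, G.Ev_le_optVal θ π']⟩

theorem robustNearRegretMin_of_isDecisive (G : BPModel Ω A) (hG : IsDecisive G.u) :
    G.RobustNearRegretMin := by
  intro ε hε
  obtain ⟨δ₀, hδ₀, π₀, h⟩ := G.exists_radius hG (by positivity : 0 < ε / 5)
  refine ⟨δ₀, hδ₀, ε / 5, by positivity, fun δ hδ Θ hΘ π' hπ' θ hθ => ?_⟩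
  have hnear := fun θ hθ => h θ fun x => (hΘ.abs_sub_le hθ x).trans hδ.le
  have h1 : G.regret Θ π₀ ≤ 2 * (ε / 5) := by
    refine csSup_le ⟨_, G.u, hΘ.mem_u, rfl⟩ ?_
    rintro _ ⟨θ, hθ, rfl⟩
    dsimp only
    linarith [hnear θ hθ]
  exact abs_lt.2 ⟨by linarith [hπ' π₀, G.le_regret hθ π', (hnear θ hθ).2, G.Ev_le_optVal θ π₀],
    by linarith [(hnear θ hθ).1, G.Ev_le_optVal θ π']⟩

end BPModel

theorem theorem2 {Ω A : Type*} [Fintype Ω] [Fintype A] [Nonempty A] :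
    IsGeneric (fun G : BPModel Ω A =>
      (G.IsContinuous ∧ G.RobustMaxMin ∧ G.RobustRegretMin) ∧
        (G.RobustNearMaxMin ∧ G.RobustNearRegretMin)) := by
  intro prior h_mem h_pos v hv
  filter_upwards [ae_uniformProfile] with u hu
  obtain ⟨hu, hdec⟩ := hu
  refine ⟨hu, ?_⟩
  set G : BPModel Ω A := ⟨prior, h_mem, h_pos, u, hu, v, hv⟩
  have h1 := G.robustNearMaxMin_of_isDecisive hdec
  have h2 := G.robustNearRegretMin_of_isDecisive hdec
  exact ⟨⟨G.isContinuous_of_isDecisive hdec, h1.robustMaxMin, h2.robustRegretMin⟩, h1, h2⟩
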